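/- Let $\mu$ be a probability distribution on $[0,\infty)$ with Laplace transform $\varphi(s)=\int e^{-sx}\,\mu(dx)$, $s\ge 0$. Then $\mu$ is compound Poisson, that is, the law of a random sum $X_1+\dots+X_N$ with $X_1,X_2,\dots$ independent and identically distributed real random variables and $N$ an independent Poisson random variable of some mean $\lambda\ge 0$, if and only if $\mu$ is infinitely divisible and there are a constant $c\ge 0$ and a distribution function $F$ on $[0,\infty)$ (a distribution function with $F(s)=0$ for $s<0$) such that $-\log\varphi(s)=c\,F(s)$ for all $s\ge 0$. In particular, an infinitely divisible distribution on $[0,\infty)$ with Laplace transform $\varphi$ is compound Poisson if and only if $-\log\varphi$ is a nonnegative multiple of a distribution function. -/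

import Mathlib

open MeasureTheory ProbabilityTheory
open scoped NNReal

noncomputable section

/-- The `n`-fold convolution power of a measure on the real line: the law of `X₁ + ⋯ + Xₙ` for
independent `Xᵢ` with law `ν` (the point mass at `0` for `n = 0`). -/
def convPower (ν : Measure ℝ) : ℕ → Measure ℝ
  | 0 => Measure.dirac 0
  | n + 1 => (convPower ν n).conv ν

/-- A law `μ` on the real line is infinitely divisible if for every `n ≥ 1` it is the law of a sum
of `n` independent and identically distributed random variables. -/
def IsInfinitelyDivisible (μ : Measure ℝ) : Prop :=
  ∀ n : ℕ, 1 ≤ n → ∃ ν : Measure ℝ, IsProbabilityMeasure ν ∧ μ = convPower ν n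

/-- The law of the random sum `X₁ + ⋯ + X_N`, where `N` is Poisson with mean `r` and is independent
of the independent random variables `Xᵢ` with law `ν`. -/
def compoundPoisson (r : ℝ≥0) (ν : Measure ℝ) : Measure ℝ :=
  Measure.sum fun n : ℕ => (poissonMeasure r {n}) • convPower ν n

/-- A law on the real line is compound Poisson if it is the law of a Poisson sum of independent and
identically distributed random variables. -/
def IsCompoundPoisson (μ : Measure ℝ) : Prop :=
  ∃ (r : ℝ≥0) (ν : Measure ℝ), IsProbabilityMeasure ν ∧ μ = compoundPoisson r ν

/-- The Laplace transform `s ↦ ∫ e^{-s x} μ(dx)`, used for laws on `[0, ∞)` and `s ≥ 0`. -/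
def laplaceTransform (μ : Measure ℝ) (s : ℝ) : ℝ :=
  ∫ x, Real.exp (-(s * x)) ∂μ

/-- The function `ψ`, given on `[0, ∞)` and continued by `0` to the negative half-line, is a
nonnegative multiple of the distribution function of a probability law. -/
def IsMultipleOfDistributionFunction (ψ : ℝ → ℝ) : Prop :=
  ∃ (c : ℝ) (ν : Measure ℝ), 0 ≤ c ∧ IsProbabilityMeasure ν ∧
    (∀ s : ℝ, 0 ≤ s → ψ s = c * cdf ν s) ∧ ∀ s : ℝ, s < 0 → cdf ν s = 0

end

/-!
The two directions rest on different descriptions of a compound Poisson law.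

If `μ` is compound Poisson with intensity `r` and jump law `ν`, every multiplicative function `f`
satisfies `∫ f dμ = exp (r (∫ f dν - 1))` (`integral_compoundPoisson_of_map_add`). For
characteristic functions this exhibits `μ` as the `n`-th convolution power of the law with intensity `r / n`. For
Laplace transforms it gives `-log φ(s) = r ∫ (1 - exp (-s x)) ν(dx)`, which is nondecreasing and
continuous in `s`, starts at `0`, and increases to `r ν((0, ∞))`.

Conversely, if `-log φ` is a multiple of a distribution function it is bounded, so
`μ {0} = lim φ(s)` as `s → ∞` is positive. Infinite divisibility gives `μ = νₙ * ⋯ * νₙ`, and the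
measures `Λₙ`, `n` times the restriction of `νₙ` to the complement of `0`, are all dominated by
`μ / μ {0}`: a sum of `n` variables lies in a set `A` avoiding `0` as soon as one of them does and
the others vanish (`nsmul_measure_mul_pow_le_convPower`). A single finite measure is tight, so by
Prokhorov's theorem the `Λₙ` have a weak limit `Λ` along an ultrafilter. Since
`n (charFun νₙ - 1) = ∫ (exp (i t x) - 1) Λₙ(dx)` is bounded, its exponential is asymptotic to
`charFun νₙ ^ n = charFun μ` (`tendsto_pow_sub_exp`). Hence
`charFun μ t = exp ∫ (exp (i t x) - 1) Λ(dx)`, and `μ` is compound Poisson with jump intensity `Λ`.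
-/

open Filter Topology

/-! ### Transforms of convolution powers and compound Poisson laws -/

instance isProbabilityMeasure_convPower (ν : Measure ℝ) [IsProbabilityMeasure ν] (n : ℕ) :
    IsProbabilityMeasure (convPower ν n) := by
  induction n with
  | zero => exact Measure.dirac.isProbabilityMeasure
  | succ n ih =>
    exact Measure.probabilitymeasure_of_probabilitymeasures_conv (convPower ν n) ν

instance isProbabilityMeasure_compoundPoisson (r : ℝ≥0) (ν : Measure ℝ) [IsProbabilityMeasure ν] :
    IsProbabilityMeasure (compoundPoisson r ν) := by
  constructor
  have h : ∑' n : ℕ, poissonMeasure r {n} = 1 := by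
    rw [← measure_univ (μ := poissonMeasure r), ← Measure.tsum_indicator_apply_singleton _ _ .univ]
    simp
  simpa [compoundPoisson, Measure.sum_apply] using h

/-- A multiplicative function such as `x ↦ exp (z * x)` turns convolution powers into powers; this
covers characteristic functions and Laplace transforms at once. -/
lemma integral_convPower_of_map_add {ν : Measure ℝ} [IsProbabilityMeasure ν] {f : ℝ → ℂ}
    (hf : Measurable f) (h0 : f 0 = 1) (hadd : ∀ x y, f (x + y) = f x * f y)
    (hν : Integrable f ν) (n : ℕ) :
    Integrable f (convPower ν n) ∧ ∫ x, f x ∂(convPower ν n) = (∫ x, f x ∂ν) ^ n := by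
  induction n with
  | zero =>
    refine ⟨integrable_dirac (by simp), ?_⟩
    simp [convPower, h0]
  | succ n ih =>
    have hint : Integrable f (convPower ν (n + 1)) := by
      rw [convPower, Measure.conv, integrable_map_measure hf.aestronglyMeasurable (by fun_prop)]
      exact (ih.1.mul_prod hν).congr (ae_of_all _ fun z => (hadd z.1 z.2).symm)
    refine ⟨hint, ?_⟩
    rw [convPower] at hint ⊢
    rw [integral_conv hint]
    simp_rw [hadd, integral_const_mul, integral_mul_const, ih.2]
    rw [pow_succ]

/-- The transform of a compound Poisson law under a multiplicative function. -/
lemma integral_compoundPoisson_of_map_add {r : ℝ≥0} {ν : Measure ℝ} [IsProbabilityMeasure ν]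
    {f : ℝ → ℂ} (hf : Measurable f) (h0 : f 0 = 1) (hadd : ∀ x y, f (x + y) = f x * f y)
    (hν : Integrable f ν) (hc : Integrable f (compoundPoisson r ν)) :
    ∫ x, f x ∂(compoundPoisson r ν) = Complex.exp (r * (∫ x, f x ∂ν - 1)) := by
  have h1 := hasSum_integral_measure hc
  set z := ∫ x, f x ∂ν
  have h2 : HasSum (fun n : ℕ => Complex.exp (-r) * ((r * z) ^ n / (n.factorial : ℂ)))
      (Complex.exp (-r) * Complex.exp (r * z)) := by
    rw [Complex.exp_eq_exp_ℂ]
    exact (NormedSpace.expSeries_div_hasSum_exp (r * z : ℂ)).mul_left _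
  rw [mul_sub, mul_one, sub_eq_neg_add, Complex.exp_add]
  refine HasSum.unique ?_ h2
  convert! h1 using 2 with n
  rw [integral_smul_measure, (integral_convPower_of_map_add hf h0 hadd hν n).2,
    ← measureReal_def, poissonMeasure_real_singleton, Complex.real_smul]
  push_cast
  ring

lemma measurable_charFun_integrand (t : ℝ) :
    Measurable fun x : ℝ => Complex.exp (t * x * Complex.I) := by
  fun_prop

lemma integrable_charFun_integrand (μ : Measure ℝ) [IsFiniteMeasure μ] (t : ℝ) :
    Integrable (fun x : ℝ => Complex.exp (t * x * Complex.I)) μ := by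
  refine Integrable.of_bound (measurable_charFun_integrand t).aestronglyMeasurable 1
    (ae_of_all _ fun x => ?_)
  rw [← Complex.ofReal_mul, Complex.norm_exp_ofReal_mul_I]

lemma charFun_convPower (ν : Measure ℝ) [IsProbabilityMeasure ν] (n : ℕ) (t : ℝ) :
    charFun (convPower ν n) t = charFun ν t ^ n := by
  simp only [charFun_apply_real]
  refine (integral_convPower_of_map_add (measurable_charFun_integrand t) (by simp)
    (fun x y => ?_) (integrable_charFun_integrand ν t) n).2
  rw [← Complex.exp_add]; push_cast; ring_nf

lemma charFun_compoundPoisson (r : ℝ≥0) (ν : Measure ℝ) [IsProbabilityMeasure ν] (t : ℝ) :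
    charFun (compoundPoisson r ν) t = Complex.exp (r * (charFun ν t - 1)) := by
  simp only [charFun_apply_real]
  refine integral_compoundPoisson_of_map_add (measurable_charFun_integrand t) (by simp)
    (fun x y => ?_) (integrable_charFun_integrand ν t) (integrable_charFun_integrand _ t)
  rw [← Complex.exp_add]; push_cast; ring_nf

/-- A compound Poisson law of intensity `r` is the `n`-th convolution power of the one of
intensity `r / n`. -/
lemma isInfinitelyDivisible_compoundPoisson (r : ℝ≥0) (ν : Measure ℝ) [IsProbabilityMeasure ν] :
    IsInfinitelyDivisible (compoundPoisson r ν) := by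
  intro n hn
  refine ⟨compoundPoisson (r / n) ν, inferInstance, Measure.ext_of_charFun (funext fun t => ?_)⟩
  have hn0 : (n : ℂ) ≠ 0 := by exact_mod_cast (by omega : n ≠ 0)
  rw [charFun_convPower, charFun_compoundPoisson, charFun_compoundPoisson, ← Complex.exp_nat_mul]
  congr 1
  push_cast
  field_simp

/-! ### Laplace transforms of laws on the half-line -/

lemma measurable_laplace_integrand (s : ℝ) : Measurable fun x : ℝ => Real.exp (-(s * x)) := by
  fun_prop

lemma ae_nonneg_of_measure_Iio_eq_zero {μ : Measure ℝ} (hμ : μ (Set.Iio 0) = 0) :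
    ∀ᵐ x ∂μ, 0 ≤ x := by
  simpa [ae_iff] using! hμ

lemma ae_laplace_integrand_le_one {μ : Measure ℝ} (hμ : μ (Set.Iio 0) = 0) {s : ℝ} (hs : 0 ≤ s) :
    ∀ᵐ x ∂μ, ‖Real.exp (-(s * x))‖ ≤ 1 := by
  filter_upwards [ae_nonneg_of_measure_Iio_eq_zero hμ] with x hx
  rw [Real.norm_eq_abs, Real.abs_exp]
  exact Real.exp_le_one_iff.2 (neg_nonpos.2 (mul_nonneg hs hx))

lemma integrable_laplace_integrand {μ : Measure ℝ} [IsFiniteMeasure μ] (hμ : μ (Set.Iio 0) = 0)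
    {s : ℝ} (hs : 0 ≤ s) : Integrable (fun x => Real.exp (-(s * x))) μ :=
  .of_bound (measurable_laplace_integrand s).aestronglyMeasurable 1
    (ae_laplace_integrand_le_one hμ hs)

lemma laplaceTransform_pos {μ : Measure ℝ} [IsProbabilityMeasure μ] (hμ : μ (Set.Iio 0) = 0)
    {s : ℝ} (hs : 0 ≤ s) : 0 < laplaceTransform μ s :=
  integral_exp_pos (integrable_laplace_integrand hμ hs)

lemma laplaceTransform_zero (μ : Measure ℝ) [IsProbabilityMeasure μ] :
    laplaceTransform μ 0 = 1 := by
  simp [laplaceTransform]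

lemma laplaceTransform_antitoneOn {μ : Measure ℝ} [IsFiniteMeasure μ] (hμ : μ (Set.Iio 0) = 0) :
    AntitoneOn (laplaceTransform μ) (Set.Ici 0) := by
  intro s hs t ht hst
  refine integral_mono_ae (integrable_laplace_integrand hμ ht)
    (integrable_laplace_integrand hμ hs) ?_
  filter_upwards [ae_nonneg_of_measure_Iio_eq_zero hμ] with x hx
  exact Real.exp_le_exp.2 (neg_le_neg (mul_le_mul_of_nonneg_right hst hx))

lemma continuous_laplaceTransform_max_zero {μ : Measure ℝ} [IsFiniteMeasure μ]
    (hμ : μ (Set.Iio 0) = 0) : Continuous fun s => laplaceTransform μ (max s 0) := by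
  refine continuous_of_dominated (bound := fun _ => 1)
    (fun s => (measurable_laplace_integrand _).aestronglyMeasurable)
    (fun s => ae_laplace_integrand_le_one hμ (le_max_right _ _)) (integrable_const _)
    (ae_of_all _ fun x => by fun_prop)

/-- The Laplace transform at infinity recovers the atom at the origin. -/
lemma tendsto_laplaceTransform_atTop {μ : Measure ℝ} [IsFiniteMeasure μ] (hμ : μ (Set.Iio 0) = 0) :
    Tendsto (laplaceTransform μ) atTop (𝓝 (μ.real {0})) := by
  rw [← integral_indicator_one (measurableSet_singleton (0 : ℝ))]
  refine tendsto_integral_filter_of_dominated_convergence (fun _ => 1)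
    (Eventually.of_forall fun s => (measurable_laplace_integrand s).aestronglyMeasurable)
    ?_ (integrable_const _) ?_
  · filter_upwards [eventually_ge_atTop 0] with s hs using ae_laplace_integrand_le_one hμ hs
  · filter_upwards [ae_nonneg_of_measure_Iio_eq_zero hμ] with x hx
    rcases hx.eq_or_lt with rfl | hx
    · simp
    · rw [Set.indicator_of_notMem (by simpa using hx.ne')]
      exact Real.tendsto_exp_neg_atTop_nhds_zero.comp (tendsto_id.atTop_mul_const hx)

lemma laplaceTransform_compoundPoisson {r : ℝ≥0} {ν : Measure ℝ} [IsProbabilityMeasure ν]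
    (hν : ν (Set.Iio 0) = 0) (hc : compoundPoisson r ν (Set.Iio 0) = 0) {s : ℝ} (hs : 0 ≤ s) :
    laplaceTransform (compoundPoisson r ν) s = Real.exp (r * (laplaceTransform ν s - 1)) := by
  have h := integral_compoundPoisson_of_map_add (r := r) (ν := ν)
    (f := fun x => ((Real.exp (-(s * x)) : ℝ) : ℂ))
    (Complex.measurable_ofReal.comp (measurable_laplace_integrand s)) (by simp)
    (fun x y => by rw [← Complex.ofReal_mul, ← Real.exp_add]; ring_nf)
    (integrable_laplace_integrand hν hs).ofReal (integrable_laplace_integrand hc hs).ofReal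
  rw [integral_complex_ofReal, integral_complex_ofReal] at h
  unfold laplaceTransform
  exact_mod_cast h

/-! ### The Laplace exponent of a compound Poisson law -/

/-- `1 - laplaceTransform ν` is a multiple of a distribution function: it is nondecreasing and
continuous from `0` at `s = 0` to the mass that `ν` gives to `(0, ∞)`. -/
lemma isMultipleOfDistributionFunction_one_sub_laplaceTransform {ν : Measure ℝ}
    [IsProbabilityMeasure ν] (hν : ν (Set.Iio 0) = 0) :
    IsMultipleOfDistributionFunction fun s => 1 - laplaceTransform ν s := by
  have hlim := tendsto_laplaceTransform_atTop hν
  have hq : ν.real {0} ≤ 1 := measureReal_le_one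
  rcases hq.eq_or_lt with hq | hq
  · refine ⟨0, Measure.dirac 0, le_rfl, inferInstance, fun s hs => ?_, fun s hs => ?_⟩
    · have h0 : laplaceTransform ν s ≤ 1 := laplaceTransform_zero ν ▸
        laplaceTransform_antitoneOn hν (Set.mem_Ici.2 le_rfl) hs hs
      have h1 : 1 ≤ laplaceTransform ν s := by
        rw [← hq]
        refine le_of_tendsto hlim ?_
        filter_upwards [eventually_ge_atTop s] with u hu
        exact laplaceTransform_antitoneOn hν hs (hs.trans hu) hu
      dsimp only
      linarith
    · rw [cdf_eq_real, measureReal_def, Measure.dirac_apply' _ measurableSet_Iic]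
      simp [hs]
  · set q := ν.real {0}
    have hq' : 0 < 1 - q := sub_pos.2 hq
    -- Composing with `max s 0` continues the function by `0` to the negative half-line.
    let F : StieltjesFunction ℝ :=
      { toFun := fun s => (1 - laplaceTransform ν (max s 0)) / (1 - q)
        mono' := fun s t hst => by
          refine div_le_div_of_nonneg_right (sub_le_sub_left ?_ _) hq'.le
          exact laplaceTransform_antitoneOn hν (le_max_right s 0) (le_max_right t 0)
            (max_le_max_right 0 hst)
        right_continuous' := fun s =>
          ((continuous_const.sub (continuous_laplaceTransform_max_zero hν)).div_const
            _).continuousWithinAt }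
    have hF (s : ℝ) : F s = (1 - laplaceTransform ν (max s 0)) / (1 - q) := rfl
    have hFneg (s : ℝ) (hs : s ≤ 0) : F s = 0 := by
      rw [hF, max_eq_right hs, laplaceTransform_zero, sub_self, zero_div]
    have hbot : Tendsto F atBot (𝓝 0) := by
      refine tendsto_const_nhds.congr' ?_
      filter_upwards [eventually_le_atBot 0] with s hs using (hFneg s hs).symm
    have htop : Tendsto F atTop (𝓝 1) := by
      have h := (hlim.const_sub 1).div_const (1 - q)
      rw [div_self hq'.ne'] at h
      refine h.congr' ?_
      filter_upwards [eventually_ge_atTop 0] with s hs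
      rw [hF, max_eq_left hs]
    refine ⟨1 - q, F.measure, hq'.le,
      ⟨by rw [F.measure_univ hbot htop, sub_zero, ENNReal.ofReal_one]⟩, fun s hs => ?_,
      fun s hs => ?_⟩
    · rw [cdf_measure_stieltjesFunction F hbot htop, hF, max_eq_left hs, mul_div_cancel₀ _ hq'.ne']
    · rw [cdf_measure_stieltjesFunction F hbot htop, hFneg s hs.le]

lemma compoundPoisson_zero (ν : Measure ℝ) [IsProbabilityMeasure ν] :
    compoundPoisson 0 ν = Measure.dirac 0 :=
  Measure.ext_of_charFun (funext fun t => by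
    rw [charFun_compoundPoisson, charFun_dirac]; simp)

/-- A compound Poisson law on the half-line with positive intensity has jumps on the half-line,
as it charges the event of exactly one jump. -/
lemma measure_Iio_eq_zero_of_compoundPoisson {r : ℝ≥0} (hr : 0 < r) {ν : Measure ℝ}
    [IsProbabilityMeasure ν] (h : compoundPoisson r ν (Set.Iio 0) = 0) : ν (Set.Iio 0) = 0 := by
  rw [compoundPoisson, Measure.sum_apply_eq_zero] at h
  have h1 := h 1
  rw [Measure.smul_apply, smul_eq_mul, mul_eq_zero] at h1
  refine (h1.resolve_left fun h0 => ?_).symm ▸ ?_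
  · exact (poissonMeasure_real_singleton_pos 1 hr).ne' (by rw [measureReal_def, h0]; rfl)
  · simp [convPower]

lemma IsMultipleOfDistributionFunction.const_mul {ψ χ : ℝ → ℝ}
    (h : IsMultipleOfDistributionFunction ψ) {r : ℝ} (hr : 0 ≤ r)
    (hχ : ∀ s, 0 ≤ s → χ s = r * ψ s) : IsMultipleOfDistributionFunction χ := by
  obtain ⟨c, ρ, hc, hρ, h1, h2⟩ := h
  exact ⟨r * c, ρ, mul_nonneg hr hc, hρ, fun s hs => by rw [hχ s hs, h1 s hs, mul_assoc], h2⟩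

lemma isMultipleOfDistributionFunction_of_isCompoundPoisson {μ : Measure ℝ}
    (hμ : μ (Set.Iio 0) = 0) (h : IsCompoundPoisson μ) :
    IsMultipleOfDistributionFunction fun s => -Real.log (laplaceTransform μ s) := by
  -- With intensity `0` the jump law is arbitrary, and may be taken to be the point mass at `0`.
  obtain ⟨r, ν, _, hν, rfl⟩ : ∃ (r : ℝ≥0) (ν : Measure ℝ), IsProbabilityMeasure ν ∧
      ν (Set.Iio 0) = 0 ∧ μ = compoundPoisson r ν := by
    obtain ⟨r, ν, _, rfl⟩ := h
    rcases eq_zero_or_pos r with rfl | hr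
    · exact ⟨0, Measure.dirac 0, inferInstance, by simp, by simp only [compoundPoisson_zero]⟩
    · exact ⟨r, ν, inferInstance, measure_Iio_eq_zero_of_compoundPoisson hr hμ, rfl⟩
  refine (isMultipleOfDistributionFunction_one_sub_laplaceTransform hν).const_mul r.coe_nonneg
    fun s hs => ?_
  rw [laplaceTransform_compoundPoisson hν hμ hs, Real.log_exp]
  ring

/-! ### Infinitely divisible laws with an atom at the origin -/

lemma measure_Iio_pow_le_convPower (ν : Measure ℝ) [IsProbabilityMeasure ν] {n : ℕ} (hn : 1 ≤ n) :
    ν (Set.Iio 0) ^ n ≤ convPower ν n (Set.Iio 0) := by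
  induction n, hn using Nat.le_induction with
  | base => simp [convPower]
  | succ n hn ih =>
    rw [convPower, Measure.conv, Measure.map_apply (by fun_prop) measurableSet_Iio, pow_succ]
    calc ν (Set.Iio 0) ^ n * ν (Set.Iio 0)
        ≤ convPower ν n (Set.Iio 0) * ν (Set.Iio 0) := by gcongr
      _ = ((convPower ν n).prod ν) (Set.Iio 0 ×ˢ Set.Iio 0) := (Measure.prod_prod _ _).symm
      _ ≤ _ := measure_mono fun z hz => add_neg (Set.mem_Iio.1 hz.1) (Set.mem_Iio.1 hz.2)

lemma measure_Iio_eq_zero_of_convPower {ν : Measure ℝ} [IsProbabilityMeasure ν] {n : ℕ}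
    (hn : 1 ≤ n) (h : convPower ν n (Set.Iio 0) = 0) : ν (Set.Iio 0) = 0 :=
  eq_zero_of_pow_eq_zero (le_zero_iff.1 (h ▸ measure_Iio_pow_le_convPower ν hn))

lemma convPower_Iio_eq_zero {ν : Measure ℝ} [IsProbabilityMeasure ν] (hν : ν (Set.Iio 0) = 0)
    (n : ℕ) : convPower ν n (Set.Iio 0) = 0 := by
  induction n with
  | zero => simp [convPower]
  | succ n ih =>
    rw [convPower, Measure.conv, Measure.map_apply (by fun_prop) measurableSet_Iio]
    refine measure_mono_null
      (t := (Set.Iio 0 ×ˢ Set.univ) ∪ (Set.univ ×ˢ Set.Iio 0)) (fun z hz => ?_) ?_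
    · by_contra hcon
      simp only [Set.mem_union, Set.mem_prod, Set.mem_Iio, Set.mem_univ, and_true, true_and,
        not_or, not_lt] at hcon
      exact (add_nonneg hcon.1 hcon.2).not_gt hz
    · rw [measure_union_null_iff, Measure.prod_prod, Measure.prod_prod, ih, hν]
      simp

/-- A sum of nonnegative variables vanishes only if all of them do. -/
lemma convPower_singleton_zero {ν : Measure ℝ} [IsProbabilityMeasure ν] (hν : ν (Set.Iio 0) = 0)
    (n : ℕ) : convPower ν n {0} = ν {0} ^ n := by
  induction n with
  | zero => simp [convPower]
  | succ n ih =>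
    rw [convPower, Measure.conv, Measure.map_apply (by fun_prop) (measurableSet_singleton _),
      pow_succ, ← ih, ← Measure.prod_prod]
    have h1 : ∀ᵐ z ∂(convPower ν n).prod ν, 0 ≤ z.1 :=
      Measure.quasiMeasurePreserving_fst.ae
        (ae_nonneg_of_measure_Iio_eq_zero (convPower_Iio_eq_zero hν n))
    have h2 : ∀ᵐ z ∂(convPower ν n).prod ν, 0 ≤ z.2 :=
      Measure.quasiMeasurePreserving_snd.ae (ae_nonneg_of_measure_Iio_eq_zero hν)
    refine measure_congr ?_
    filter_upwards [h1, h2] with z hz1 hz2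
    exact propext (add_eq_zero_iff_of_nonneg hz1 hz2)

/-- Among the events that lead `X₁ + ⋯ + Xₙ` into a set `A` avoiding the origin are the `n`
disjoint ones where one summand is in `A` and all others vanish. -/
lemma nsmul_measure_mul_pow_le_convPower {ν : Measure ℝ} [IsProbabilityMeasure ν] {A : Set ℝ}
    (hA : MeasurableSet A) (h0 : (0 : ℝ) ∉ A) (n : ℕ) :
    n * ν A * ν {0} ^ n ≤ convPower ν n A := by
  -- The induction needs the sharp exponent `n - 1` and a bound for the atom at `0`.
  suffices h : n * ν A * ν {0} ^ (n - 1) ≤ convPower ν n A ∧ ν {0} ^ n ≤ convPower ν n {0} from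
    (mul_le_mul_right (pow_le_pow_of_le_one zero_le prob_le_one (n.sub_le 1)) _).trans h.1
  induction n with
  | zero => simp [convPower]
  | succ n ih =>
    have hdisj : Disjoint (A ×ˢ {(0 : ℝ)}) ({(0 : ℝ)} ×ˢ A) := by
      rw [Set.disjoint_left]
      rintro ⟨x, y⟩ ⟨hx, _⟩ ⟨hx', _⟩
      exact h0 (by rw [← Set.mem_singleton_iff.1 hx']; exact hx)
    constructor
    · rw [convPower, Measure.conv, Measure.map_apply (by fun_prop) hA]
      calc ((n + 1 : ℕ) : ENNReal) * ν A * ν {0} ^ (n + 1 - 1)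
          = n * ν A * ν {0} ^ (n - 1) * ν {0} + ν {0} ^ n * ν A := by
            rcases n with _ | n
            · simp
            · simp only [Nat.add_sub_cancel, pow_succ]; push_cast; ring
        _ ≤ convPower ν n A * ν {0} + convPower ν n {0} * ν A := by
            gcongr
            exacts [ih.1, ih.2]
        _ = ((convPower ν n).prod ν) ((A ×ˢ {0}) ∪ ({0} ×ˢ A)) := by
            rw [measure_union hdisj ((measurableSet_singleton _).prod hA), Measure.prod_prod,
              Measure.prod_prod]
        _ ≤ _ := measure_mono ?_
      rintro ⟨x, y⟩ (⟨hx, hy⟩ | ⟨hx, hy⟩)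
      · obtain rfl := Set.mem_singleton_iff.1 hy
        simpa using hx
      · obtain rfl := Set.mem_singleton_iff.1 hx
        simpa using hy
    · rw [convPower, Measure.conv, Measure.map_apply (by fun_prop) (measurableSet_singleton _),
        pow_succ]
      calc ν {0} ^ n * ν {0} ≤ convPower ν n {0} * ν {0} := by gcongr; exact ih.2
        _ = ((convPower ν n).prod ν) ({0} ×ˢ {0}) := (Measure.prod_prod _ _).symm
        _ ≤ _ := measure_mono (by rintro ⟨x, y⟩ ⟨hx, hy⟩; simp_all)

lemma norm_pow_sub_pow_le {a b : ℂ} (ha : ‖a‖ ≤ 1) (hb : ‖b‖ ≤ 1) (n : ℕ) :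
    ‖a ^ n - b ^ n‖ ≤ n * ‖a - b‖ := by
  induction n with
  | zero => simp
  | succ n ih =>
    calc ‖a ^ (n + 1) - b ^ (n + 1)‖ = ‖a ^ n * (a - b) + (a ^ n - b ^ n) * b‖ := by
          congr 1; ring
      _ ≤ ‖a ^ n‖ * ‖a - b‖ + ‖a ^ n - b ^ n‖ * ‖b‖ := by
          refine (norm_add_le _ _).trans (by rw [norm_mul, norm_mul])
      _ ≤ 1 * ‖a - b‖ + n * ‖a - b‖ * 1 := by
          gcongr
          rw [norm_pow]
          exact pow_le_one₀ (norm_nonneg _) ha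
      _ = _ := by push_cast; ring

/-- If `n * (a n - 1)` stays bounded and the `a n` are in the unit disc, then `a n ^ n` is
asymptotically `exp (n * (a n - 1))`. -/
lemma tendsto_pow_sub_exp {a : ℕ → ℂ} (ha : ∀ n, ‖a n‖ ≤ 1) {C : ℝ}
    (hC : ∀ n : ℕ, 1 ≤ n → ‖(n : ℂ) * (a n - 1)‖ ≤ C) :
    Tendsto (fun n => a n ^ n - Complex.exp (n * (a n - 1))) atTop (𝓝 0) := by
  refine squeeze_zero_norm' (a := fun n : ℕ => C ^ 2 / n) ?_
    (tendsto_const_div_atTop_nhds_zero_nat _)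
  filter_upwards [eventually_ge_atTop 1, eventually_ge_atTop ⌈C⌉₊] with n hn hnC
  have hn0 : (0 : ℝ) < n := by exact_mod_cast hn
  have hg : ‖a n - 1‖ ≤ C / n := by
    have h := hC n hn
    rw [norm_mul, Complex.norm_natCast] at h
    rwa [le_div_iff₀' hn0]
  have hg1 : ‖a n - 1‖ ≤ 1 := hg.trans ((div_le_one hn0).2 (Nat.ceil_le.1 hnC))
  have hexp : ‖Complex.exp (a n - 1)‖ ≤ 1 := by
    rw [Complex.norm_exp, Real.exp_le_one_iff, Complex.sub_re, Complex.one_re, sub_nonpos]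
    exact (Complex.re_le_norm _).trans (ha n)
  rw [Complex.exp_nat_mul]
  refine (norm_pow_sub_pow_le (ha n) hexp n).trans ?_
  have h2 : ‖a n - Complex.exp (a n - 1)‖ ≤ ‖a n - 1‖ ^ 2 := by
    have h := Complex.norm_exp_sub_one_sub_id_le hg1
    rwa [sub_sub, add_sub_cancel, norm_sub_rev] at h
  calc n * ‖a n - Complex.exp (a n - 1)‖ ≤ n * (C / n) ^ 2 := by
        gcongr
        exact h2.trans (by gcongr)
    _ = C ^ 2 / n := by field_simp

/-- Finite measures dominated by a fixed finite measure form a relatively compact set for weak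
convergence, as a single finite measure on the line is tight. -/
lemma exists_ultrafilter_limit_of_le (μ : Measure ℝ) [IsFiniteMeasure μ] (Λ : ℕ → FiniteMeasure ℝ)
    (h : ∀ n, (Λ n : Measure ℝ) ≤ μ) :
    ∃ Λ₀ : FiniteMeasure ℝ, Tendsto Λ (hyperfilter ℕ) (𝓝 Λ₀) := by
  have hu : Tendsto (fun n : ℕ => (μ (Metric.closedBall (0 : ℝ) n)ᶜ).toNNReal) atTop (𝓝 0) := by
    have h1 : Tendsto (fun n : ℕ => μ (Metric.closedBall (0 : ℝ) n)ᶜ) atTop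
        (𝓝 (μ (⋂ n : ℕ, (Metric.closedBall (0 : ℝ) n)ᶜ))) := by
      refine tendsto_measure_iInter_atTop
        (fun n => Metric.isClosed_closedBall.measurableSet.compl.nullMeasurableSet)
        (fun m n hmn => Set.compl_subset_compl.2
          (Metric.closedBall_subset_closedBall (by exact_mod_cast hmn))) ⟨0, measure_ne_top _ _⟩
    rw [← Set.compl_iUnion, Metric.iUnion_closedBall_nat, Set.compl_univ, measure_empty] at h1
    exact (ENNReal.tendsto_toNNReal ENNReal.zero_ne_top).comp h1
  have hK := isCompact_setOfPred_finiteMeasure_mass_le_compl_isCompact_le (E := ℝ)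
    (μ Set.univ).toNNReal hu (fun n => isCompact_closedBall (0 : ℝ) n) (Or.inl inferInstance)
  have hle (n : ℕ) (s : Set ℝ) : Λ n s ≤ (μ s).toNNReal :=
    ENNReal.toNNReal_mono (measure_ne_top _ _) (h n s)
  obtain ⟨Λ₀, -, hΛ₀⟩ := hK.ultrafilter_le_nhds ((hyperfilter ℕ).map Λ) (by
    rw [Ultrafilter.coe_map, le_principal_iff, mem_map]
    exact Eventually.of_forall fun n => ⟨hle n _, fun k => hle n _⟩)
  exact ⟨Λ₀, hΛ₀⟩

lemma tendsto_charFun_of_tendsto_finiteMeasure {ι : Type*} {l : Filter ι}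
    {Λ : ι → FiniteMeasure ℝ} {Λ₀ : FiniteMeasure ℝ} (h : Tendsto Λ l (𝓝 Λ₀)) (t : ℝ) :
    Tendsto (fun i => charFun (Λ i : Measure ℝ) t) l (𝓝 (charFun (Λ₀ : Measure ℝ) t)) := by
  rw [FiniteMeasure.tendsto_iff_forall_integral_rclike_tendsto ℂ] at h
  simp_rw [charFun_eq_integral_innerProbChar]
  exact h (BoundedContinuousFunction.innerProbChar t)

/-- A finite measure `Λ` is the jump intensity of a compound Poisson law, with characteristic
function `exp ∫ (exp (i t x) - 1) Λ(dx)`. -/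
lemma exists_charFun_compoundPoisson (Λ : FiniteMeasure ℝ) :
    ∃ (r : ℝ≥0) (ν : Measure ℝ), IsProbabilityMeasure ν ∧ ∀ t,
      charFun (compoundPoisson r ν) t =
        Complex.exp (charFun (Λ : Measure ℝ) t - charFun (Λ : Measure ℝ) 0) := by
  refine ⟨Λ.mass, Λ.normalize, inferInstance, fun t => ?_⟩
  have h (t : ℝ) : charFun (Λ : Measure ℝ) t = Λ.mass * charFun (Λ.normalize : Measure ℝ) t := by
    conv_lhs => rw [Λ.self_eq_mass_smul_normalize]
    rw [FiniteMeasure.toMeasure_smul, charFun_apply, charFun_apply]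
    rw [integral_smul_nnreal_measure]
    simp [NNReal.smul_def]
  rw [charFun_compoundPoisson, h t, h 0, charFun_zero]
  simp [mul_sub]

/-- An infinitely divisible law on the half-line with an atom at the origin is compound Poisson.
The jump intensity is a weak limit of `n νₙ` restricted to the complement of the origin, where
`μ` is the `n`-th convolution power of `νₙ`. -/
lemma isCompoundPoisson_of_isInfinitelyDivisible {μ : Measure ℝ} [IsProbabilityMeasure μ]
    (hμ : μ (Set.Iio 0) = 0) (h0 : μ {0} ≠ 0) (h : IsInfinitelyDivisible μ) :
    IsCompoundPoisson μ := by
  -- The roots of `μ`, with a probability measure as the value at the unused index `0`.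
  obtain ⟨ν, hνp, hν⟩ : ∃ ν : ℕ → Measure ℝ, (∀ n, IsProbabilityMeasure (ν n)) ∧
      ∀ n, 1 ≤ n → μ = convPower (ν n) n := by
    have h' (n : ℕ) : ∃ ν : Measure ℝ, IsProbabilityMeasure ν ∧ (1 ≤ n → μ = convPower ν n) := by
      rcases Nat.eq_zero_or_pos n with rfl | hn
      · exact ⟨μ, inferInstance, fun h => absurd h (by norm_num)⟩
      · obtain ⟨ν, h1, h2⟩ := h n hn
        exact ⟨ν, h1, fun _ => h2⟩
    choose ν h1 h2 using h'
    exact ⟨ν, h1, h2⟩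
  let Λ (n : ℕ) : FiniteMeasure ℝ :=
    (n : ℝ≥0) • ⟨(ν n).restrict {0}ᶜ, inferInstance⟩
  have hΛ (n : ℕ) : (Λ n : Measure ℝ) = (n : ℝ≥0) • (ν n).restrict {0}ᶜ := rfl
  have hcinv : (μ {0})⁻¹ ≠ ⊤ := ENNReal.inv_ne_top.2 h0
  have : IsFiniteMeasure ((μ {0})⁻¹ • μ) := Measure.smul_finite μ hcinv
  have hdom (n : ℕ) : (Λ n : Measure ℝ) ≤ (μ {0})⁻¹ • μ := by
    rcases Nat.eq_zero_or_pos n with rfl | hn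
    · rw [hΛ, Nat.cast_zero, zero_smul]
      exact Measure.zero_le _
    refine Measure.le_iff.2 fun A hA => ?_
    have hνn : ν n (Set.Iio 0) = 0 := measure_Iio_eq_zero_of_convPower hn (hν n hn ▸ hμ)
    have hpow : μ {0} = ν n {0} ^ n := by
      conv_lhs => rw [hν n hn]
      exact convPower_singleton_zero hνn n
    rw [Measure.smul_apply, smul_eq_mul, mul_comm, ← div_eq_mul_inv,
      ENNReal.le_div_iff_mul_le (Or.inl h0) (Or.inl (measure_ne_top _ _)), hΛ, Measure.smul_apply,
      Measure.restrict_apply hA, hpow]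
    calc _ = (n : ENNReal) * ν n (A ∩ {0}ᶜ) * ν n {0} ^ n := by
          simp [ENNReal.smul_def]
      _ ≤ convPower (ν n) n (A ∩ {0}ᶜ) :=
          nsmul_measure_mul_pow_le_convPower (hA.inter (measurableSet_singleton _).compl)
            (by simp) n
      _ = μ (A ∩ {0}ᶜ) := by rw [← hν n hn]
      _ ≤ μ A := measure_mono Set.inter_subset_left
  obtain ⟨Λ₀, hΛ₀⟩ := exists_ultrafilter_limit_of_le _ Λ hdom
  have hchar (n : ℕ) (t : ℝ) : charFun (Λ n : Measure ℝ) t - charFun (Λ n : Measure ℝ) 0 =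
      n * (charFun (ν n) t - 1) := by
    have hsplit (t : ℝ) : charFun (Λ n : Measure ℝ) t = n * (charFun (ν n) t - (ν n).real {0}) := by
      rw [hΛ, charFun_apply_real, integral_smul_nnreal_measure, charFun_apply_real,
        ← integral_add_compl (measurableSet_singleton (0 : ℝ))
          (integrable_charFun_integrand (ν n) t), integral_singleton]
      simp [NNReal.smul_def]
    rw [hsplit, hsplit, charFun_zero, probReal_univ]
    push_cast
    ring
  obtain ⟨r, ρ, _, hρ⟩ := exists_charFun_compoundPoisson Λ₀
  refine ⟨r, ρ, inferInstance, Measure.ext_of_charFun (funext fun t => ?_)⟩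
  rw [hρ]
  set M : ℝ := ((μ {0})⁻¹ • μ).real Set.univ
  have hM (n : ℕ) (t : ℝ) : ‖charFun (Λ n : Measure ℝ) t‖ ≤ M :=
    (norm_charFun_le t).trans (ENNReal.toReal_mono (measure_ne_top _ _) (hdom n _))
  have hpow := tendsto_pow_sub_exp (a := fun n => charFun (ν n) t)
    (fun n => norm_charFun_le_one t) (C := M + M) fun n _ => by
      rw [← hchar]
      exact (norm_sub_le _ _).trans (add_le_add (hM n t) (hM n 0))
  have hexp : Tendsto (fun n : ℕ => Complex.exp (n * (charFun (ν n) t - 1))) (hyperfilter ℕ)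
      (𝓝 (Complex.exp (charFun (Λ₀ : Measure ℝ) t - charFun (Λ₀ : Measure ℝ) 0))) := by
    simp_rw [← hchar]
    exact (Complex.continuous_exp.tendsto _).comp
      ((tendsto_charFun_of_tendsto_finiteMeasure hΛ₀ t).sub
        (tendsto_charFun_of_tendsto_finiteMeasure hΛ₀ 0))
  have hsum := (hpow.mono_left Nat.hyperfilter_le_atTop).add hexp
  simp only [sub_add_cancel, zero_add] at hsum
  refine tendsto_nhds_unique (tendsto_const_nhds.congr' ?_) hsum
  have hge : ∀ᶠ n in (hyperfilter ℕ : Filter ℕ), 1 ≤ n :=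
    Nat.hyperfilter_le_atTop (eventually_ge_atTop 1)
  filter_upwards [hge] with n hn
  conv_lhs => rw [hν n hn]
  exact charFun_convPower (ν n) n t

/-! ### Characterization by the Laplace exponent -/

/-- A bounded Laplace exponent `-log φ` keeps `φ` away from `0`, hence leaves an atom at `0`. -/
lemma measure_singleton_zero_ne_zero_of_isMultipleOfDistributionFunction {μ : Measure ℝ}
    [IsProbabilityMeasure μ] (hμ : μ (Set.Iio 0) = 0)
    (h : IsMultipleOfDistributionFunction fun s => -Real.log (laplaceTransform μ s)) :
    μ {0} ≠ 0 := by
  obtain ⟨c, ρ, hc, _, h1, -⟩ := h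
  have hle : Real.exp (-c) ≤ μ.real {0} := by
    refine ge_of_tendsto (tendsto_laplaceTransform_atTop hμ) ?_
    filter_upwards [eventually_ge_atTop 0] with s hs
    rw [← Real.le_log_iff_exp_le (laplaceTransform_pos hμ hs)]
    have h2 := h1 s hs
    have h3 := mul_le_of_le_one_right hc (cdf_le_one ρ s)
    dsimp only at h2
    linarith
  intro h0
  rw [measureReal_def, h0] at hle
  exact (Real.exp_pos _).not_ge hle

theorem corollary1 (μ : Measure ℝ) [IsProbabilityMeasure μ] (hμ : μ (Set.Iio 0) = 0) :
    IsCompoundPoisson μ ↔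
      IsInfinitelyDivisible μ ∧
        IsMultipleOfDistributionFunction (fun s => -Real.log (laplaceTransform μ s)) := by
  refine ⟨fun h => ⟨?_, isMultipleOfDistributionFunction_of_isCompoundPoisson hμ h⟩, fun h => ?_⟩
  · obtain ⟨r, ν, _, rfl⟩ := h
    exact isInfinitelyDivisible_compoundPoisson r ν
  · exact isCompoundPoisson_of_isInfinitelyDivisible hμ
      (measure_singleton_zero_ne_zero_of_isMultipleOfDistributionFunction hμ h.2) h.1
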